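/- Fix real numbers $0<c<b<a$. For each integer $n\ge 2$ let $X_1,\dots,X_n$ be independent random variables, each uniformly distributed on $[0,1]$, and put $d(u,v)=\min\{|X_u-X_v|,\,1-|X_u-X_v|\}$. Let $G_n$ be the random graph on the vertex set $\{1,\dots,n\}$ in which two distinct vertices $u,v$ are adjacent if and only if $$d(u,v)\in\Big[0,\,c\,\frac{\log n}{n}\Big]\cup\Big[b\,\frac{\log n}{n},\,a\,\frac{\log n}{n}\Big],$$ where $\log$ is the natural logarithm. If $a-b+c>1$, or if $a-b>\tfrac12$ and $a>1$, then $G_n$ is connected with probability $1-o(1)$, that is, $\lim_{n\to\infty}\Pr(G_n\text{ is connected})=1$. -/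

import Mathlib

open Set Filter Topology MeasureTheory

/-- The distance `d_L(x, y) = min {|x - y|, 1 - |x - y|}` on `[0, 1]`
(geodesic distance on the circle of circumference one). -/
noncomputable def circleDist (x y : ℝ) : ℝ :=
  min |x - y| (1 - |x - y|)

theorem circleDist_comm (x y : ℝ) : circleDist x y = circleDist y x := by
  unfold circleDist
  rw [abs_sub_comm]

/-- The graph on the vertices `0, …, n - 1` with positions `X`, in which two distinct vertices
are adjacent if and only if the distance of their positions lies in the connectivity set `S`. -/
noncomputable def vertexGraph {n : ℕ} (S : Set ℝ) (X : Fin n → ℝ) : SimpleGraph (Fin n) where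
  Adj u v := u ≠ v ∧ circleDist (X u) (X v) ∈ S
  symm := ⟨fun u v h => ⟨h.1.symm, by rw [circleDist_comm]; exact h.2⟩⟩
  loopless := ⟨fun _ h => h.1 rfl⟩

/-- The joint law of `n` independent random positions, each uniform on `[0, 1]`. -/
noncomputable def positionLaw (n : ℕ) : Measure (Fin n → ℝ) :=
  Measure.pi fun _ => (volume : Measure ℝ).restrict (Icc 0 1)

/-- The connectivity set `[0, c log n / n] ∪ [b log n / n, a log n / n]`. -/
noncomputable def patchSet (a b c : ℝ) (n : ℕ) : Set ℝ :=
  Icc 0 (c * Real.log n / n) ∪ Icc (b * Real.log n / n) (a * Real.log n / n)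

/-- The probability that the random graph on `n` vertices with independent uniform positions and
connectivity set `S` is connected. -/
noncomputable def probConnected (n : ℕ) (S : Set ℝ) : ℝ :=
  (positionLaw n).real {X | (vertexGraph S X).Connected}

/-! Either alternative gives a > 1 and 2(a - b) + c > 1, and only these two inequalities matter. Cut
[0, 1] into N cells of length just under log n / (kn), k a large constant. In cell units the
thresholds A, B, C are about ak, bk, ck. A union bound shows that, with high probability, every
window of a fixed number of cells has fewer than m = k + 2 empty cells, and that the cells near both
ends are occupied.

The rest is deterministic. A block, M ≥ A consecutive occupied cells, is internally connected and
too long for an edge to jump over. By pigeonhole, blocks recur within m * M cells. If a component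
misses a block, its last vertex before that block sees vertex-free gaps of lengths C and A - B to
its right; the mirror statement holds on the left. A vertex connected to neither of two nearby
blocks, or two such blocks in different components, would thus force gaps of total length at least
min(2(A - B) + C, A) in one window, more than fewer than m empty cells allow (`sum_length_lt`).
Induction along the blocks connects everything. -/

/-! ### Deterministic connectivity of dense layouts -/

/-- The cell `[i, i + 1)` contains one of the points `y v`. -/
def CellOccupied {V : Type*} (y : V → ℝ) (i : ℕ) : Prop :=
  ∃ v, (i : ℝ) ≤ y v ∧ y v < i + 1

/-- All of the `M` consecutive cells starting with the cell `p` are occupied. -/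
def BlockOccupied {V : Type*} (y : V → ℝ) (M p : ℕ) : Prop :=
  ∀ i, p ≤ i → i < p + M → CellOccupied y i

/-- A graph whose vertices have positions `y` in `[0, N)`, in which vertices at a distance in
`[0, C] ∪ [B, A]` are adjacent, and whose positions leave less than `m` cells empty in every window
of `m * M + M` cells and none among the first and the last `M` cells. -/
structure DenseLayout {V : Type*} (G : SimpleGraph V) (y : V → ℝ) (A B C : ℝ) (m M N : ℕ) :
    Prop where
  two_le : 2 ≤ C
  lt_inner : C < B
  inner_le : B ≤ A
  le_block : A ≤ M
  le_two_mul : m + 8 ≤ 2 * (A - B) + C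
  le_outer : m + 8 ≤ A
  block_le : M ≤ N
  adj_near : ∀ v w, v ≠ w → |y v - y w| ≤ C → G.Adj v w
  adj_far : ∀ v w, v ≠ w → B ≤ |y v - y w| → |y v - y w| ≤ A → G.Adj v w
  nonneg : ∀ v, 0 ≤ y v
  lt_card : ∀ v, y v < N
  sparse : ∀ (s : ℕ) (T : Finset ℕ),
    (∀ i ∈ T, s ≤ i ∧ i < s + (m * M + M) ∧ i < N ∧ ¬ CellOccupied y i) → T.card < m
  first : BlockOccupied y M 0
  last : BlockOccupied y M (N - M)

namespace DenseLayout

variable {V : Type*} {G : SimpleGraph V} {y : V → ℝ} {A B C : ℝ} {m M N : ℕ}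

theorem reachable_near (h : DenseLayout G y A B C m M N) {v w : V} (hvw : |y v - y w| ≤ C) :
    G.Reachable v w := by
  by_cases e : v = w
  · rw [e]
  · exact (h.adj_near v w e hvw).reachable

theorem reachable_far (h : DenseLayout G y A B C m M N) {v w : V} (h1 : B ≤ |y v - y w|)
    (h2 : |y v - y w| ≤ A) : G.Reachable v w := by
  by_cases e : v = w
  · rw [e]
  · exact (h.adj_far v w e h1 h2).reachable

/-- Points in neighbouring cells are less than 2 ≤ C apart, so a chain through consecutive cells
works. -/
theorem reachable_block (h : DenseLayout G y A B C m M N) {p : ℕ} (hp : BlockOccupied y M p)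
    {v w : V} (hv : (p : ℝ) ≤ y v) (hv' : y v < p + M) (hw : (p : ℝ) ≤ y w)
    (hw' : y w < p + M) : G.Reachable v w := by
  have hC := h.two_le
  have key : ∀ k : ℕ, k < M → ∀ v w : V, (p : ℝ) ≤ y v → y v < p + 1 →
      ((p + k : ℕ) : ℝ) ≤ y w → y w < (p + k : ℕ) + 1 → G.Reachable v w := by
    intro k
    induction k with
    | zero =>
      intro _ v w h1 h2 h3 h4
      push_cast at h3 h4
      exact h.reachable_near (abs_le.2 ⟨by linarith, by linarith⟩)
    | succ k ih =>
      intro hk v w h1 h2 h3 h4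
      obtain ⟨x, hx, hx'⟩ := hp (p + k) (by omega) (by omega)
      refine (ih (by omega) v x h1 h2 hx hx').trans ?_
      push_cast at h3 h4 hx hx'
      exact h.reachable_near (abs_le.2 ⟨by linarith, by linarith⟩)
  have hM : 0 < M := by
    rcases Nat.eq_zero_or_pos M with h0 | h0
    · rw [h0] at hv'
      push_cast at hv'
      linarith
    · exact h0
  obtain ⟨x, hx, hx'⟩ := hp p le_rfl (by omega)
  have go : ∀ v : V, (p : ℝ) ≤ y v → y v < p + M → G.Reachable x v := by
    intro v h1 h2
    have h3 : p ≤ ⌊y v⌋₊ := Nat.le_floor h1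
    have h4 : ⌊y v⌋₊ < p + M := (Nat.floor_lt (h.nonneg v)).2 (by push_cast; exact h2)
    refine key (⌊y v⌋₊ - p) (by omega) x v hx hx' ?_ ?_
    · rw [Nat.add_sub_cancel' h3]
      exact Nat.floor_le (h.nonneg v)
    · rw [Nat.add_sub_cancel' h3]
      exact Nat.lt_floor_add_one (y v)
  exact (go v hv hv').symm.trans (go w hw hw')

/-- Four consecutive disjoint open intervals without points are short. -/
theorem sum_length_lt (h : DenseLayout G y A B C m M N) {p q : ℕ} (hpq : q ≤ p + m * M)
    (hq : q + M ≤ N) {a₁ b₁ a₂ b₂ a₃ b₃ a₄ b₄ : ℝ} (hp : (p : ℝ) ≤ a₁)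
    (h1 : a₁ ≤ b₁) (h1' : b₁ ≤ a₂) (h2 : a₂ ≤ b₂) (h2' : b₂ ≤ a₃) (h3 : a₃ ≤ b₃)
    (h3' : b₃ ≤ a₄) (h4 : a₄ ≤ b₄) (hb : b₄ ≤ q + M)
    (e1 : ∀ v, a₁ < y v → b₁ ≤ y v) (e2 : ∀ v, a₂ < y v → b₂ ≤ y v)
    (e3 : ∀ v, a₃ < y v → b₃ ≤ y v) (e4 : ∀ v, a₄ < y v → b₄ ≤ y v) :
    (b₁ - a₁) + (b₂ - a₂) + (b₃ - a₃) + (b₄ - a₄) < m + 8 := by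
  have hp0 : (0 : ℝ) ≤ p := Nat.cast_nonneg p
  -- Cells lying wholly in (a, b). Starting at ⌊a⌋ + 1 leaves out a vertex at a itself. At most 2
  -- units of length are lost per interval, hence the 8 for four intervals.
  let I : ℝ → ℝ → Finset ℕ := fun a b => Finset.Ico (⌊a⌋₊ + 1) ⌊b⌋₊
  have mem : ∀ {a b : ℝ} {i : ℕ}, 0 ≤ a → a ≤ b → i ∈ I a b → a < i ∧ (i : ℝ) + 1 ≤ b := by
    intro a b i ha hab hi
    obtain ⟨hi, hi'⟩ := Finset.mem_Ico.1 hi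
    refine ⟨(Nat.floor_lt ha).1 (by omega), ?_⟩
    have := (Nat.le_floor_iff (ha.trans hab)).1 (Nat.succ_le_of_lt hi')
    push_cast at this
    exact this
  have card : ∀ {a b : ℝ}, 0 ≤ a → b - a - 2 ≤ (I a b).card := by
    intro a b ha
    have h5 : (⌊b⌋₊ : ℝ) ≤ (I a b).card + (⌊a⌋₊ + 1) := by
      simp only [I, Nat.card_Ico]
      norm_cast
      omega
    have h6 := Nat.lt_floor_add_one b
    have h7 := Nat.floor_le ha
    linarith
  have dis : ∀ {a b a' b' : ℝ}, 0 ≤ a → a ≤ b → b ≤ a' → a' ≤ b' →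
      Disjoint (I a b) (I a' b') := by
    intro a b a' b' ha hab hba hab'
    rw [Finset.disjoint_left]
    intro i hi hi'
    have := mem ha hab hi
    have := mem (ha.trans (hab.trans hba)) hab' hi'
    linarith
  have emp : ∀ {a b : ℝ} {i : ℕ}, (p : ℝ) ≤ a → a ≤ b → b ≤ q + M → (∀ v, a < y v → b ≤ y v) →
      i ∈ I a b → p ≤ i ∧ i < p + (m * M + M) ∧ i < N ∧ ¬ CellOccupied y i := by
    intro a b i ha hab hbq he hi
    obtain ⟨hi, hi'⟩ := mem (hp0.trans ha) hab hi
    have h5 : p ≤ i := by exact_mod_cast (ha.trans_lt hi).le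
    have h6 : i + 1 ≤ q + M := by exact_mod_cast hi'.trans hbq
    refine ⟨h5, by omega, by omega, ?_⟩
    rintro ⟨v, hv, hv'⟩
    have := he v (hi.trans_le hv)
    linarith
  have lt := h.sparse p (I a₁ b₁ ∪ I a₂ b₂ ∪ I a₃ b₃ ∪ I a₄ b₄) (by
    intro i hi
    simp only [Finset.mem_union] at hi
    rcases hi with ((hi | hi) | hi) | hi
    · exact emp (by linarith) h1 (by linarith) e1 hi
    · exact emp (by linarith) h2 (by linarith) e2 hi
    · exact emp (by linarith) h3 (by linarith) e3 hi
    · exact emp (by linarith) h4 (by linarith) e4 hi)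
  rw [Finset.card_union_of_disjoint, Finset.card_union_of_disjoint,
    Finset.card_union_of_disjoint] at lt
  · have lt' : ((I a₁ b₁).card : ℝ) + (I a₂ b₂).card + (I a₃ b₃).card + (I a₄ b₄).card < m := by
      exact_mod_cast lt
    have := card (a := a₁) (b := b₁) (by linarith)
    have := card (a := a₂) (b := b₂) (by linarith)
    have := card (a := a₃) (b := b₃) (by linarith)
    have := card (a := a₄) (b := b₄) (by linarith)
    linarith
  · exact dis (by linarith) h1 (by linarith) h2
  · rw [Finset.disjoint_union_left]
    exact ⟨dis (by linarith) h1 (by linarith) h3, dis (by linarith) h2 (by linarith) h3⟩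
  · rw [Finset.disjoint_union_left, Finset.disjoint_union_left]
    exact ⟨⟨dis (by linarith) h1 (by linarith) h4, dis (by linarith) h2 (by linarith) h4⟩,
      dis (by linarith) h3 (by linarith) h4⟩

/-- The rightmost vertex before position `q` among those reachable from `z`, if these avoid
`[q, q + M)`. -/
theorem exists_rightmost [Finite V] (h : DenseLayout G y A B C m M N) {q : ℕ} {z : V}
    (hz : y z < q) (hq : ∀ v, G.Reachable z v → (q : ℝ) ≤ y v → (q : ℝ) + M ≤ y v) :
    ∃ u, G.Reachable z u ∧ y z ≤ y u ∧ y u < q ∧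
      (∀ v, G.Reachable z v → y v < q → y v ≤ y u) ∧
      (∀ v, y u < y v → y u + C < y v) ∧ (∀ v, y u + B ≤ y v → y u + A < y v) := by
  obtain ⟨u, ⟨hu, huq⟩, hmax⟩ := Set.exists_max_image {v | G.Reachable z v ∧ y v < q} y
    (Set.toFinite _) ⟨z, SimpleGraph.Reachable.refl z, hz⟩
  have hA := h.le_block
  have hBA := h.inner_le
  have hCB := h.lt_inner
  have hC := h.two_le
  -- A component vertex to the right of u lies beyond the whole range [q, q + M), and M ≥ A.
  have far : ∀ v, G.Reachable u v → y u < y v → y u + A < y v := by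
    intro v hv huv
    have hzv := hu.trans hv
    by_contra hcon
    push Not at hcon
    rcases lt_or_ge (y v) q with hlt | hge
    · exact absurd (hmax v ⟨hzv, hlt⟩) (not_le.2 huv)
    · have := hq v hzv hge
      linarith
  refine ⟨u, hu, hmax z ⟨SimpleGraph.Reachable.refl z, hz⟩, huq, fun v h1 h2 => hmax v ⟨h1, h2⟩,
    fun v hv => ?_, fun v hv => ?_⟩
  · by_contra hcon
    push Not at hcon
    have := far v (h.reachable_near (abs_le.2 ⟨by linarith, by linarith⟩)) hv
    linarith
  · by_contra hcon
    push Not at hcon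
    have e : |y u - y v| = y v - y u := by
      rw [abs_sub_comm, abs_of_nonneg (by linarith)]
    have := far v (h.reachable_far (by rw [e]; linarith) (by rw [e]; linarith)) (by linarith)
    linarith

/-- The leftmost vertex after position `p + M` among those reachable from `z`, if these avoid
`[p, p + M)`. -/
theorem exists_leftmost [Finite V] (h : DenseLayout G y A B C m M N) {p : ℕ} {z : V}
    (hz : (p : ℝ) + M ≤ y z) (hp : ∀ v, G.Reachable z v → y v < p + M → y v < p) :
    ∃ u, G.Reachable z u ∧ y u ≤ y z ∧ (p : ℝ) + M ≤ y u ∧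
      (∀ v, G.Reachable z v → (p : ℝ) + M ≤ y v → y u ≤ y v) ∧
      (∀ v, y u - C < y v → y u ≤ y v) ∧ (∀ v, y u - A < y v → y u - B ≤ y v) := by
  obtain ⟨u, ⟨hu, hup⟩, hmin⟩ := Set.exists_min_image {v | G.Reachable z v ∧ (p : ℝ) + M ≤ y v} y
    (Set.toFinite _) ⟨z, SimpleGraph.Reachable.refl z, hz⟩
  have hA := h.le_block
  have hBA := h.inner_le
  have hCB := h.lt_inner
  have hC := h.two_le
  have far : ∀ v, G.Reachable u v → y v < y u → y v < y u - A := by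
    intro v hv huv
    have hzv := hu.trans hv
    by_contra hcon
    push Not at hcon
    rcases lt_or_ge (y v) (p + M) with hlt | hge
    · have := hp v hzv hlt
      linarith
    · exact absurd (hmin v ⟨hzv, hge⟩) (not_le.2 huv)
  refine ⟨u, hu, hmin z ⟨SimpleGraph.Reachable.refl z, hz⟩, hup, fun v h1 h2 => hmin v ⟨h1, h2⟩,
    fun v hv => ?_, fun v hv => ?_⟩
  · by_contra hcon
    push Not at hcon
    have := far v (h.reachable_near (abs_le.2 ⟨by linarith, by linarith⟩)) hcon
    linarith
  · by_contra hcon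
    push Not at hcon
    have e : |y u - y v| = y u - y v := abs_of_nonneg (by linarith)
    have := far v (h.reachable_far (by rw [e]; linarith) (by rw [e]; linarith)) (by linarith)
    linarith

/-- A vertex between two blocks close to each other is reachable from one of them. -/
theorem exists_reachable_block [Finite V] (h : DenseLayout G y A B C m M N) {p q : ℕ}
    (hpq : q ≤ p + m * M) (hq : q + M ≤ N) {z : V} (hz : (p : ℝ) ≤ y z) (hz' : y z < q + M) :
    ∃ v, G.Reachable z v ∧
      (((p : ℝ) ≤ y v ∧ y v < p + M) ∨ ((q : ℝ) ≤ y v ∧ y v < q + M)) := by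
  by_contra! hcon
  have hp1 : ∀ v, G.Reachable z v → y v < p + M → y v < p := fun v hv hvM => by
    by_contra! hc
    exact absurd hvM (not_lt.2 ((hcon v hv).1 hc))
  have hq1 : ∀ v, G.Reachable z v → (q : ℝ) ≤ y v → (q : ℝ) + M ≤ y v :=
    fun v hv => (hcon v hv).2
  have hzp : (p : ℝ) + M ≤ y z := (hcon z (SimpleGraph.Reachable.refl z)).1 hz
  have hzq : y z < q := by
    by_contra! hc
    exact absurd hz' (not_lt.2 (hq1 z (SimpleGraph.Reachable.refl z) hc))
  obtain ⟨u, -, huz, huq, -, hu1, hu2⟩ := h.exists_rightmost hzq hq1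
  obtain ⟨w, -, hwz, hwp, -, hw1, hw2⟩ := h.exists_leftmost hzp hp1
  have hA := h.le_block
  have hBA := h.inner_le
  have hCB := h.lt_inner
  have hC := h.two_le
  have hlen := h.le_two_mul
  -- Since w ≤ z ≤ u in position, the gaps left of w and right of u are disjoint.
  have := h.sum_length_lt hpq hq (a₁ := y w - A) (b₁ := y w - B) (a₂ := y w - C) (b₂ := y w)
    (a₃ := y u) (b₃ := y u + C) (a₄ := y u + B) (b₄ := y u + A) (by linarith) (by linarith)
    (by linarith) (by linarith) (by linarith) (by linarith) (by linarith) (by linarith)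
    (by linarith) hw2 hw1 (fun v hv => (hu1 v hv).le) (fun v hv => (hu2 v hv.le).le)
  linarith

theorem block_pos (h : DenseLayout G y A B C m M N) : 0 < M := by
  have h1 := h.le_block
  have h2 := h.le_outer
  have h3 : (0 : ℝ) ≤ m := Nat.cast_nonneg m
  have : (0 : ℝ) < M := by linarith
  exact_mod_cast this

/-- Two blocks close to each other are in the same component. -/
theorem reachable_blocks [Finite V] (h : DenseLayout G y A B C m M N) {p q : ℕ} (hlt : p < q)
    (hpq : q ≤ p + m * M) (hq : q + M ≤ N) (hp' : BlockOccupied y M p)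
    (hq' : BlockOccupied y M q) {v w : V} (hv : (p : ℝ) ≤ y v) (hv' : y v < p + M)
    (hw : (q : ℝ) ≤ y w) (hw' : y w < q + M) : G.Reachable v w := by
  by_contra hcon
  have hpos := h.block_pos
  have hlt' : (p : ℝ) + 1 ≤ q := by exact_mod_cast hlt
  -- The blocks may overlap; taking x in the first cell of one and t in the last cell of the other
  -- ensures that x lies before q and t after p + M.
  obtain ⟨x, hx, hx'⟩ := hp' p le_rfl (by omega)
  obtain ⟨t, ht, ht'⟩ := hq' (q + M - 1) (by omega) (by omega)
  have hcast : ((q + M - 1 : ℕ) : ℝ) = q + M - 1 := by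
    rw [Nat.cast_sub (by omega)]
    push_cast
    ring
  rw [hcast] at ht ht'
  have hM1 : (1 : ℝ) ≤ M := by exact_mod_cast hpos
  have left : ∀ s : V, (p : ℝ) ≤ y s → y s < p + M → G.Reachable x s := fun s h1 h2 =>
    h.reachable_block hp' hx (by linarith) h1 h2
  have right : ∀ s : V, (q : ℝ) ≤ y s → y s < q + M → G.Reachable t s := fun s h1 h2 =>
    h.reachable_block hq' (by linarith) (by linarith) h1 h2
  have hxt : ∀ s, G.Reachable x s → G.Reachable t s → False := fun s h1 h2 =>
    hcon ((left v hv hv').symm.trans (h1.trans (h2.symm.trans (right w hw hw'))))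
  obtain ⟨u, hxu, hxy, huq, humax, hu1, hu2⟩ := h.exists_rightmost (z := x) (q := q)
    (by linarith) (fun s hs hqs => by
      by_contra! hc
      exact hxt s hs (right s hqs hc))
  obtain ⟨u', htu, hty, hup, humin, hu1', hu2'⟩ := h.exists_leftmost (z := t) (p := p)
    (by linarith) (fun s hs hps => by
      by_contra! hc
      exact hxt s (left s hc hps) hs)
  have hA := h.le_block
  have hBA := h.inner_le
  have hCB := h.lt_inner
  have hC := h.two_le
  have hlen := h.le_two_mul
  have hlen' := h.le_outer
  -- If u' is not to the right of u, the four gaps are disjoint as before.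
  rcases le_or_gt (y u') (y u) with hle | hgt
  · have := h.sum_length_lt hpq hq (a₁ := y u' - A) (b₁ := y u' - B) (a₂ := y u' - C)
      (b₂ := y u') (a₃ := y u) (b₃ := y u + C) (a₄ := y u + B) (b₄ := y u + A) (by linarith)
      (by linarith) (by linarith) (by linarith) (by linarith) (by linarith) (by linarith)
      (by linarith) (by linarith) hu2' hu1' (fun v hv => (hu1 v hv).le)
      (fun v hv => (hu2 v hv.le).le)
    linarith
  -- A vertex strictly between u and u' would belong to one of the two components, against the
  -- extremality of u or u'.
  have gap : ∀ s, y u < y s → y u' ≤ y s := by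
    intro s hs
    by_contra! hs'
    obtain ⟨r, hr, hr' | hr'⟩ := h.exists_reachable_block hpq hq (z := s) (p := p)
      (by linarith) (by linarith)
    · have hxs : G.Reachable x s := (left r hr'.1 hr'.2).trans hr.symm
      rcases lt_or_ge (y s) q with h1 | h1
      · exact absurd (humax s hxs h1) (not_le.2 hs)
      · exact hxt s hxs (right s h1 (by linarith))
    · have hts : G.Reachable t s := (right r hr'.1 hr'.2).trans hr.symm
      rcases lt_or_ge (y s) (p + M) with h1 | h1
      · exact hxt s (left s (by linarith) h1) hts
      · exact absurd (humin s hts h1) (not_le.2 hs')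
  have hgC := hu1 u' hgt
  -- Either the middle gap, longer than C, lies between two gaps of length A - B, or it alone
  -- exceeds A. Empty intervals fill the unused slots.
  rcases lt_or_ge (y u') (y u + B) with hgB | hgB
  · have := h.sum_length_lt hpq hq (a₁ := y u' - A) (b₁ := y u' - B) (a₂ := y u)
      (b₂ := y u') (a₃ := y u') (b₃ := y u') (a₄ := y u + B) (b₄ := y u + A) (by linarith)
      (by linarith) (by linarith) (by linarith) (by linarith) (by linarith) (by linarith)
      (by linarith) (by linarith) hu2' gap (fun v hv => hv.le)
      (fun v hv => (hu2 v hv.le).le)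
    linarith
  · have hgA := hu2 u' hgB
    have := h.sum_length_lt hpq hq (a₁ := y u) (b₁ := y u') (a₂ := y u')
      (b₂ := y u') (a₃ := y u') (b₃ := y u') (a₄ := y u') (b₄ := y u') (by linarith)
      (by linarith) le_rfl le_rfl le_rfl le_rfl le_rfl le_rfl
      (by linarith) gap (fun v hv => hv.le) (fun v hv => hv.le) (fun v hv => hv.le)
    linarith

/-- Not far to the left of each position there is a block. -/
theorem exists_block_before (h : DenseLayout G y A B C m M N) {p : ℕ} (hp : 0 < p)
    (hpN : p ≤ N) : ∃ q, q < p ∧ p ≤ q + m * M ∧ BlockOccupied y M q := by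
  have hpos := h.block_pos
  have hm : 0 < m := by
    have := h.sparse 0 ∅ (by simp)
    simpa using this
  rcases Nat.lt_or_ge p (m * M) with hlt | hge
  · exact ⟨0, hp, by omega, h.first⟩
  by_contra! hcon
  -- Each of the m disjoint runs of M cells just before p would contain an empty cell.
  have hne : ∀ j : ℕ, j < m → ∃ i, p - (j + 1) * M ≤ i ∧ i < p - (j + 1) * M + M ∧
      ¬ CellOccupied y i := by
    intro j hj
    have h1 : (j + 1) * M ≤ m * M := Nat.mul_le_mul_right M hj
    have h2 : 0 < (j + 1) * M := Nat.mul_pos (Nat.succ_pos j) hpos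
    have := hcon (p - (j + 1) * M) (by omega) (by omega)
    unfold BlockOccupied at this
    push Not at this
    exact this
  choose! f hf1 hf2 hf3 using hne
  have key : ∀ j j' : ℕ, j < j' → j' < m → f j' < f j := by
    intro j j' hjj hj'
    have h1 : (j' + 1) * M ≤ m * M := Nat.mul_le_mul_right M hj'
    have h2 : (j + 1 + 1) * M ≤ (j' + 1) * M := Nat.mul_le_mul_right M (by omega)
    have h3 := hf1 j (by omega)
    have h4 := hf2 j' hj'
    have h5 : (j + 1 + 1) * M = (j + 1) * M + M := by ring
    omega
  have inj : Set.InjOn f (Finset.range m) := by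
    intro j hj j' hj' he
    have hj := Finset.mem_range.1 hj
    have hj' := Finset.mem_range.1 hj'
    rcases lt_trichotomy j j' with hl | hl | hl
    · have := key j j' hl hj'
      omega
    · exact hl
    · have := key j' j hl hj
      omega
  have hcard := h.sparse (p - m * M) ((Finset.range m).image f) (by
    intro i hi
    obtain ⟨j, hj, rfl⟩ := Finset.mem_image.1 hi
    have hj := Finset.mem_range.1 hj
    have h1 : (j + 1) * M ≤ m * M := Nat.mul_le_mul_right M hj
    have h2 : (j + 1) * M = j * M + M := by ring
    have h3 := hf1 j hj
    have h4 := hf2 j hj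
    exact ⟨by omega, by omega, by omega, hf3 j hj⟩)
  rw [Finset.card_image_of_injOn inj, Finset.card_range] at hcard
  exact lt_irrefl _ hcard

/-- Strong induction on the block: step back to a nearby earlier block, and treat vertices between
the two with `exists_reachable_block`. -/
theorem reachable_of_lt [Finite V] (h : DenseLayout G y A B C m M N) (p : ℕ)
    (hp : BlockOccupied y M p) (hpN : p + M ≤ N) {v w : V} (hv : y v < p + M)
    (hw : (p : ℝ) ≤ y w) (hw' : y w < p + M) : G.Reachable v w := by
  induction p using Nat.strong_induction_on generalizing v w with
  | _ p ih =>
    rcases Nat.eq_zero_or_pos p with h0 | h0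
    · subst h0
      exact h.reachable_block hp (by simpa using h.nonneg v) hv hw hw'
    obtain ⟨q, hqp, hpq, hq⟩ := h.exists_block_before h0 (by omega)
    have hpos := h.block_pos
    have hM1 : (1 : ℝ) ≤ M := by exact_mod_cast hpos
    obtain ⟨x, hx, hx'⟩ := hq q le_rfl (by omega)
    have hxw : G.Reachable x w :=
      h.reachable_blocks hqp hpq hpN hq hp hx (by linarith) hw hw'
    rcases lt_or_ge (y v) q with hlt | hge
    · exact (ih q hqp hq (by omega) (by linarith) hx (by linarith)).trans hxw
    · obtain ⟨r, hr, hr' | hr'⟩ := h.exists_reachable_block hpq hpN hge hv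
      · exact hr.trans (h.reachable_blocks hqp hpq hpN hq hp hr'.1 hr'.2 hw hw')
      · exact hr.trans (h.reachable_block hp hr'.1 hr'.2 hw hw')

theorem connected [Finite V] (h : DenseLayout G y A B C m M N) : G.Connected := by
  have hpos := h.block_pos
  have hMN := h.block_le
  have hM1 : (1 : ℝ) ≤ M := by exact_mod_cast hpos
  obtain ⟨x, hx, hx'⟩ := h.last (N - M) le_rfl (by omega)
  have hN : ((N - M : ℕ) : ℝ) + M = N := by exact_mod_cast Nat.sub_add_cancel hMN
  have key : ∀ v, G.Reachable v x := fun v =>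
    h.reachable_of_lt (N - M) h.last (by omega) (by rw [hN]; exact h.lt_card v) hx
      (by linarith)
  have : Nonempty V := ⟨x⟩
  exact ⟨fun v w => (key v).trans (key w).symm⟩

end DenseLayout


/-! ### Probability bounds for empty cells -/

instance isProbabilityMeasure_restrict_Icc :
    IsProbabilityMeasure ((volume : Measure ℝ).restrict (Icc 0 1)) :=
  ⟨by simp⟩

instance isProbabilityMeasure_positionLaw (n : ℕ) : IsProbabilityMeasure (positionLaw n) := by
  unfold positionLaw
  infer_instance

/-- The union of the intervals `[i / N, (i + 1) / N)` with `i ∈ T`. -/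
def cellUnion (N : ℕ) (T : Finset ℕ) : Set ℝ :=
  ⋃ i ∈ T, Ico ((i : ℝ) / N) (((i : ℝ) + 1) / N)

theorem measurableSet_cellUnion (N : ℕ) (T : Finset ℕ) : MeasurableSet (cellUnion N T) :=
  Finset.measurableSet_biUnion T fun _ _ => measurableSet_Ico

theorem measureReal_cellUnion {N : ℕ} (hN : 0 < N) {T : Finset ℕ} (hT : T ⊆ Finset.range N) :
    ((volume : Measure ℝ).restrict (Icc 0 1)).real (cellUnion N T) = T.card / N := by
  have hN' : (0 : ℝ) < N := by exact_mod_cast hN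
  have hsub : ∀ i ∈ T, Ico ((i : ℝ) / N) (((i : ℝ) + 1) / N) ⊆ Icc 0 1 := by
    intro i hi x hx
    have hi : (i : ℝ) + 1 ≤ N := by exact_mod_cast Finset.mem_range.1 (hT hi)
    exact ⟨(by positivity : (0 : ℝ) ≤ i / N).trans hx.1,
      hx.2.le.trans ((div_le_one hN').2 hi)⟩
  unfold cellUnion
  rw [measureReal_biUnion_finset]
  · rw [Finset.sum_congr rfl (g := fun _ => 1 / (N : ℝ))]
    · simp [div_eq_mul_inv]
    · intro i hi
      rw [measureReal_restrict_apply measurableSet_Ico, inter_eq_self_of_subset_left (hsub i hi),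
        Real.volume_real_Ico_of_le (by gcongr; linarith)]
      ring
  · intro i _ j _ hij
    rw [Function.onFun, Set.disjoint_left]
    rintro x ⟨h1, h2⟩ ⟨h3, h4⟩
    rw [div_le_iff₀ hN'] at h1 h3
    rw [lt_div_iff₀ hN'] at h2 h4
    have h5 : (i : ℝ) < j + 1 := by linarith
    have h6 : (j : ℝ) < i + 1 := by linarith
    norm_cast at h5 h6
    omega
  · intro i _
    exact measurableSet_Ico

theorem cellOccupied_iff {n N : ℕ} (hN : 0 < N) (X : Fin n → ℝ) (i : ℕ) :
    CellOccupied (fun v => N * X v) i ↔ ∃ v, X v ∈ Ico ((i : ℝ) / N) (((i : ℝ) + 1) / N) := by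
  have hN' : (0 : ℝ) < N := by exact_mod_cast hN
  simp only [CellOccupied, mem_Ico, div_le_iff₀' hN', lt_div_iff₀' hN']

/-- The probability that all cells of a given set are empty. -/
theorem positionLaw_empty_le {n N : ℕ} (hN : 0 < N) {T : Finset ℕ} (hT : T ⊆ Finset.range N) :
    (positionLaw n).real {X | ∀ i ∈ T, ¬ CellOccupied (fun v => N * X v) i} ≤
      Real.exp (-(T.card / N * n)) := by
  have hN' : (0 : ℝ) < N := by exact_mod_cast hN
  have hset : {X : Fin n → ℝ | ∀ i ∈ T, ¬ CellOccupied (fun v => N * X v) i} =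
      Set.univ.pi fun _ => (cellUnion N T)ᶜ := by
    ext X
    simp only [cellOccupied_iff hN, cellUnion, mem_ofPred_eq, Set.mem_pi, mem_univ, true_implies,
      mem_compl_iff, mem_iUnion, not_exists]
    exact ⟨fun h v i hi => h i hi v, fun h i hi v => h v i hi⟩
  have hcard : (T.card : ℝ) ≤ N := by
    have := Finset.card_le_card hT
    rw [Finset.card_range] at this
    exact_mod_cast this
  rw [hset, positionLaw, measureReal_def, Measure.pi_pi, Finset.prod_const, Finset.card_univ,
    Fintype.card_fin, ENNReal.toReal_pow, ← measureReal_def,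
    probReal_compl_eq_one_sub (measurableSet_cellUnion N T), measureReal_cellUnion hN hT]
  calc (1 - (T.card : ℝ) / N) ^ n ≤ Real.exp (-(T.card / N)) ^ n := by
        refine pow_le_pow_left₀ (sub_nonneg.2 ((div_le_one hN').2 hcard)) ?_ n
        exact Real.one_sub_le_exp_neg _
    _ = Real.exp (-(T.card / N * n)) := by
        rw [← Real.exp_nat_mul]
        ring_nf

/-- Every window of `W` cells contains less than `m` empty cells. -/
def SparseEmpty {n : ℕ} (m W N : ℕ) (X : Fin n → ℝ) : Prop :=
  ∀ (s : ℕ) (T : Finset ℕ),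
    (∀ i ∈ T, s ≤ i ∧ i < s + W ∧ i < N ∧ ¬ CellOccupied (fun v => N * X v) i) → T.card < m

theorem positionLaw_not_sparseEmpty_le {n m W N : ℕ} (hN : 0 < N) (hm : 0 < m) :
    (positionLaw n).real {X | ¬ SparseEmpty m W N X} ≤
      N * (W.choose m * Real.exp (-(m / N * n))) := by
  let P : ℕ → Finset (Finset ℕ) := fun s =>
    ((Finset.Ico s (s + W)).powersetCard m).filter fun T => T ⊆ Finset.range N
  let E : Finset ℕ → Set (Fin n → ℝ) := fun T =>
    {X | ∀ i ∈ T, ¬ CellOccupied (fun v => N * X v) i}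
  have hsub : {X : Fin n → ℝ | ¬ SparseEmpty m W N X} ⊆
      ⋃ s ∈ Finset.range N, ⋃ T ∈ P s, E T := by
    intro X hX
    simp only [SparseEmpty, mem_ofPred_eq] at hX
    push Not at hX
    obtain ⟨s, T, hT, hmT⟩ := hX
    obtain ⟨T', hT', hc⟩ := Finset.exists_subset_card_eq hmT
    obtain ⟨i, hi⟩ := Finset.card_pos.1 (hc ▸ hm)
    simp only [mem_iUnion]
    refine ⟨s, Finset.mem_range.2 ?_, T', ?_, fun j hj => (hT j (hT' hj)).2.2.2⟩
    · have := hT i (hT' hi)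
      omega
    · refine Finset.mem_filter.2 ⟨Finset.mem_powersetCard.2 ⟨fun j hj => ?_, hc⟩, fun j hj => ?_⟩
      · exact Finset.mem_Ico.2 ⟨(hT j (hT' hj)).1, (hT j (hT' hj)).2.1⟩
      · exact Finset.mem_range.2 (hT j (hT' hj)).2.2.1
  have hE : ∀ s, (positionLaw n).real (⋃ T ∈ P s, E T) ≤
      W.choose m * Real.exp (-(m / N * n)) := by
    intro s
    refine (measureReal_biUnion_finset_le _ _).trans ?_
    refine (Finset.sum_le_card_nsmul _ _ (Real.exp (-(m / N * n))) ?_).trans ?_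
    · intro T hT
      obtain ⟨h1, h2⟩ := Finset.mem_filter.1 hT
      have := positionLaw_empty_le (n := n) hN h2
      rwa [(Finset.mem_powersetCard.1 h1).2] at this
    · rw [nsmul_eq_mul]
      gcongr
      refine (Finset.card_filter_le _ _).trans ?_
      simp
  refine (measureReal_mono hsub (measure_ne_top _ _)).trans ((measureReal_biUnion_finset_le _ _).trans ?_)
  refine (Finset.sum_le_card_nsmul _ _ _ fun s _ => hE s).trans ?_
  rw [nsmul_eq_mul, Finset.card_range]

theorem positionLaw_not_blockOccupied_le {n M N p : ℕ} (hN : 0 < N) (hp : p + M ≤ N) :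
    (positionLaw n).real {X | ¬ BlockOccupied (fun v => N * X v) M p} ≤
      M * Real.exp (-(1 / N * n)) := by
  have hsub : {X : Fin n → ℝ | ¬ BlockOccupied (fun v => N * X v) M p} ⊆
      ⋃ i ∈ Finset.Ico p (p + M),
        {X | ∀ j ∈ ({i} : Finset ℕ), ¬ CellOccupied (fun v => N * X v) j} := by
    intro X hX
    simp only [BlockOccupied, mem_ofPred_eq] at hX
    push Not at hX
    obtain ⟨i, h1, h2, h3⟩ := hX
    simp only [mem_iUnion]
    exact ⟨i, Finset.mem_Ico.2 ⟨h1, h2⟩, by simpa using h3⟩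
  refine (measureReal_mono hsub (measure_ne_top _ _)).trans ((measureReal_biUnion_finset_le _ _).trans ?_)
  refine (Finset.sum_le_card_nsmul _ _ (Real.exp (-(1 / N * n))) ?_).trans ?_
  · intro i hi
    have hi := Finset.mem_Ico.1 hi
    have := positionLaw_empty_le (n := n) hN (T := {i})
      (Finset.singleton_subset_iff.2 (Finset.mem_range.2 (by omega)))
    simpa using this
  · rw [nsmul_eq_mul]
    simp

/-- Discards the position 1, which lies in none of the N cells. -/
theorem positionLaw_not_mem_Ico (n : ℕ) :
    (positionLaw n).real {X | ¬ ∀ v, X v ∈ Ico (0 : ℝ) 1} = 0 := by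
  have h : ∀ᵐ X ∂positionLaw n, ∀ v, X v ∈ Ico (0 : ℝ) 1 := by
    rw [ae_all_iff]
    intro v
    have h0 : ∀ᵐ x ∂(volume : Measure ℝ).restrict (Icc 0 1), x ∈ Ico (0 : ℝ) 1 := by
      rw [← restrict_Ico_eq_restrict_Icc]
      exact ae_restrict_mem measurableSet_Ico
    exact (measurePreserving_eval
      (fun _ : Fin n => (volume : Measure ℝ).restrict (Icc 0 1)) v).quasiMeasurePreserving.ae h0
  rw [measureReal_def, ae_iff.1 h, ENNReal.toReal_zero]

theorem circleDist_of_abs_le_half {x y : ℝ} (h : |x - y| ≤ 1 / 2) : circleDist x y = |x - y| :=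
  min_eq_left (by linarith)

/-- As a * L ≤ 1 / 2, circle distance equals |x - y| in the range used; edges across the endpoint 0
are not needed. -/
theorem denseLayout_vertexGraph {n m M N : ℕ} {L a b c : ℝ} {X : Fin n → ℝ} (hN : 0 < N)
    (hcb : c * L < b * L) (hba : b * L ≤ a * L) (haL : a * L ≤ 1 / 2)
    (h1 : 2 ≤ N * (c * L)) (h2 : N * (a * L) ≤ M)
    (h3 : m + 8 ≤ 2 * (N * (a * L) - N * (b * L)) + N * (c * L)) (h4 : m + 8 ≤ N * (a * L))
    (hMN : M ≤ N) (hX : ∀ v, X v ∈ Ico (0 : ℝ) 1) (hs : SparseEmpty m (m * M + M) N X)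
    (hf : BlockOccupied (fun v => N * X v) M 0)
    (hl : BlockOccupied (fun v => N * X v) M (N - M)) :
    DenseLayout (vertexGraph (Icc 0 (c * L) ∪ Icc (b * L) (a * L)) X) (fun v => N * X v)
      (N * (a * L)) (N * (b * L)) (N * (c * L)) m M N := by
  have hN' : (0 : ℝ) < N := by exact_mod_cast hN
  have habs : ∀ v w, |N * X v - N * X w| = N * |X v - X w| := fun v w => by
    rw [← mul_sub, abs_mul, abs_of_pos hN']
  refine ⟨h1, by gcongr, by gcongr, h2, h3, h4, hMN, ?_, ?_, ?_, ?_, hs, hf, hl⟩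
  · intro v w hvw h
    rw [habs] at h
    have h := le_of_mul_le_mul_left h hN'
    refine ⟨hvw, ?_⟩
    rw [circleDist_of_abs_le_half (by linarith)]
    exact Or.inl ⟨abs_nonneg _, h⟩
  · intro v w hvw h h'
    rw [habs] at h h'
    have h := le_of_mul_le_mul_left h hN'
    have h' := le_of_mul_le_mul_left h' hN'
    refine ⟨hvw, ?_⟩
    rw [circleDist_of_abs_le_half (by linarith)]
    exact Or.inr ⟨h, h'⟩
  · exact fun v => mul_nonneg hN'.le (hX v).1
  · intro v
    have := mul_lt_mul_of_pos_left (hX v).2 hN'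
    linarith

theorem one_sub_probConnected_le {n m M N : ℕ} {L a b c : ℝ} (hN : 0 < N) (hm : 0 < m)
    (hcb : c * L < b * L) (hba : b * L ≤ a * L) (haL : a * L ≤ 1 / 2)
    (h1 : 2 ≤ N * (c * L)) (h2 : N * (a * L) ≤ M)
    (h3 : m + 8 ≤ 2 * (N * (a * L) - N * (b * L)) + N * (c * L)) (h4 : m + 8 ≤ N * (a * L))
    (hMN : M ≤ N) :
    1 - probConnected n (Icc 0 (c * L) ∪ Icc (b * L) (a * L)) ≤
      N * ((m * M + M).choose m * Real.exp (-(m / N * n))) + 2 * (M * Real.exp (-(1 / N * n))) := by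
  let S : Set ℝ := Icc 0 (c * L) ∪ Icc (b * L) (a * L)
  -- Covering the whole space needs only monotonicity and subadditivity, not measurability of
  -- connectedness.
  have hsub : (univ : Set (Fin n → ℝ)) ⊆ {X | (vertexGraph S X).Connected} ∪
      ({X | ¬ ∀ v, X v ∈ Ico (0 : ℝ) 1} ∪ ({X | ¬ SparseEmpty m (m * M + M) N X} ∪
        ({X | ¬ BlockOccupied (fun v => N * X v) M 0} ∪
          {X | ¬ BlockOccupied (fun v => N * X v) M (N - M)}))) := by
    intro X _
    by_contra hcon
    simp only [mem_union, mem_ofPred_eq] at hcon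
    push Not at hcon
    exact hcon.1 (denseLayout_vertexGraph hN hcb hba haL h1 h2 h3 h4 hMN hcon.2.1 hcon.2.2.1
      hcon.2.2.2.1 hcon.2.2.2.2).connected
  have hle := measureReal_mono (μ := positionLaw n) hsub
  rw [probReal_univ] at hle
  have u1 := measureReal_union_le (μ := positionLaw n) {X | (vertexGraph S X).Connected}
    ({X | ¬ ∀ v, X v ∈ Ico (0 : ℝ) 1} ∪ ({X | ¬ SparseEmpty m (m * M + M) N X} ∪
        ({X | ¬ BlockOccupied (fun v => N * X v) M 0} ∪
          {X | ¬ BlockOccupied (fun v => N * X v) M (N - M)})))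
  have u2 := measureReal_union_le (μ := positionLaw n) {X | ¬ ∀ v, X v ∈ Ico (0 : ℝ) 1}
    ({X | ¬ SparseEmpty m (m * M + M) N X} ∪
        ({X | ¬ BlockOccupied (fun v => N * X v) M 0} ∪
          {X | ¬ BlockOccupied (fun v => N * X v) M (N - M)}))
  have u3 := measureReal_union_le (μ := positionLaw n) {X | ¬ SparseEmpty m (m * M + M) N X}
    ({X | ¬ BlockOccupied (fun v => N * X v) M 0} ∪
          {X | ¬ BlockOccupied (fun v => N * X v) M (N - M)})
  have u4 := measureReal_union_le (μ := positionLaw n)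
    {X | ¬ BlockOccupied (fun v => N * X v) M 0}
    {X | ¬ BlockOccupied (fun v => N * X v) M (N - M)}
  have b1 := positionLaw_not_mem_Ico n
  have b2 := positionLaw_not_sparseEmpty_le (n := n) (W := m * M + M) hN hm
  have b3 := positionLaw_not_blockOccupied_le (n := n) (M := M) (p := 0) hN (by omega)
  have b4 := positionLaw_not_blockOccupied_le (n := n) (M := M) (p := N - M) hN (by omega)
  have hdef : probConnected n (Icc 0 (c * L) ∪ Icc (b * L) (a * L)) =
    (positionLaw n).real {X | (vertexGraph S X).Connected} := rfl
  linarith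

/-! ### Choice of scale and the limit -/

theorem tendsto_log_div_atTop :
    Tendsto (fun n : ℕ => Real.log n / n) atTop (𝓝 0) :=
  (Real.isLittleO_log_id_atTop.tendsto_div_nhds_zero).comp tendsto_natCast_atTop_atTop

/-- Cells of length `1 / N`, slightly shorter than `log n / (k * n)`, make the exceptional
probability vanish. -/
theorem tendsto_probConnected {a b c : ℝ} (hc : 0 < c) (hcb : c < b) (hba : b < a)
    (h1 : 1 < 2 * (a - b) + c) (h2 : 1 < a) :
    Tendsto (fun n : ℕ => probConnected n (patchSet a b c n)) atTop (𝓝 1) := by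
  -- Ensures ck ≥ 2, and that (2(a - b) + c)k and ak are at least k + 10 = m + 8 for m = k + 2.
  obtain ⟨k, hk⟩ := exists_nat_ge (max (2 / c) (max (10 / (2 * (a - b) + c - 1)) (10 / (a - 1))))
  simp only [max_le_iff, div_le_iff₀ hc, div_le_iff₀ (sub_pos.2 h1), div_le_iff₀ (sub_pos.2 h2)]
    at hk
  obtain ⟨hk1, hk2, hk3⟩ := hk
  have hk0 : (0 : ℝ) ≤ k := Nat.cast_nonneg k
  have ha0 : 0 < a := by linarith
  have hab : 0 < a - b := sub_pos.2 hba
  let M : ℕ := ⌈a * k⌉₊ + 1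
  let D : ℝ := (((k + 2) * M + M).choose (k + 2) : ℕ) + 2 * M
  have hlog : Tendsto (fun n : ℕ => Real.log n) atTop atTop :=
    Real.tendsto_log_atTop.comp tendsto_natCast_atTop_atTop
  have hlim : Tendsto (fun n : ℕ => 1 - D * Real.exp (-(Real.log n / (k + 1)))) atTop (𝓝 1) := by
    have h0 : Tendsto (fun n : ℕ => Real.exp (-(Real.log n / (k + 1)))) atTop (𝓝 0) :=
      Real.tendsto_exp_neg_atTop_nhds_zero.comp (hlog.atTop_div_const (by positivity))
    simpa using (h0.const_mul D).const_sub 1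
  refine tendsto_of_tendsto_of_tendsto_of_le_of_le' hlim tendsto_const_nhds ?_
    (Eventually.of_forall fun n => measureReal_le_one)
  -- Here L < 1 gives N * L ≤ k + 1, L < 1 / (2a) gives a * L ≤ 1 / 2 and A ≤ M, and L < k / (M + 1)
  -- gives M < N.
  have hsmall := tendsto_log_div_atTop.eventually_lt_const
    (show (0 : ℝ) < min (min 1 (1 / (2 * a))) (k / (M + 1)) by
      have : (0 : ℝ) < k := by
        by_contra hcon
        have : (k : ℝ) = 0 := le_antisymm (not_lt.1 hcon) hk0
        rw [this] at hk1
        linarith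
      positivity)
  filter_upwards [hsmall, hlog.eventually_ge_atTop (k + 1), eventually_gt_atTop 0]
    with n hn hlogn hn0
  have hn0' : (0 : ℝ) < n := by exact_mod_cast hn0
  have hlogpos : 0 < Real.log n := by linarith
  set L : ℝ := Real.log n / n with hL
  have hLpos : 0 < L := div_pos hlogpos hn0'
  simp only [lt_min_iff] at hn
  obtain ⟨⟨hL1, hL2⟩, hL3⟩ := hn
  rw [lt_div_iff₀ (by positivity)] at hL2 hL3
  let N : ℕ := ⌈k / L⌉₊
  have hN1 : k ≤ N * L := by
    rw [← div_le_iff₀ hLpos]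
    exact Nat.le_ceil _
  have hN2 : N * L ≤ k + L := by
    have := (Nat.ceil_lt_add_one (show (0 : ℝ) ≤ k / L by positivity)).le
    calc N * L ≤ (k / L + 1) * L := by gcongr
      _ = k + L := by field_simp
  have hMa : a * k ≤ M - 1 := by
    have := Nat.le_ceil (a * k)
    simp only [M]
    push_cast
    linarith
  have hMN : (M : ℝ) + 1 ≤ N := by
    by_contra! hcon
    have : N * L ≤ (M + 1) * L := by gcongr
    linarith
  have hMN' : M + 1 ≤ N := by exact_mod_cast hMN
  have hNpos : 0 < N := by omega
  have hNpos' : (0 : ℝ) < N := by exact_mod_cast hNpos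
  have hrate : Real.log n / (k + 1) ≤ 1 / N * n := by
    have h3 : N * (Real.log n) ≤ (k + 1) * n := by
      have : N * L * n ≤ (k + 1) * n := by
        gcongr
        linarith
      rwa [hL, mul_assoc, div_mul_cancel₀ _ hn0'.ne'] at this
    rw [one_div_mul_eq_div, div_le_div_iff₀ (by positivity) hNpos']
    linarith
  have hNn : (N : ℝ) ≤ n := by
    have h3 : N * (Real.log n) ≤ (k + 1) * n := by
      rw [one_div_mul_eq_div, div_le_div_iff₀ (by positivity) hNpos'] at hrate
      linarith
    have h4 : N * ((k : ℝ) + 1) ≤ N * Real.log n := by gcongr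
    have h5 : (k + 1 : ℝ) * N ≤ (k + 1) * n := by linarith
    exact le_of_mul_le_mul_left h5 (by positivity)
  have hpatch : patchSet a b c n = Icc 0 (c * L) ∪ Icc (b * L) (a * L) := by
    simp only [patchSet, hL, mul_div_assoc]
  have hmain := one_sub_probConnected_le (n := n) (m := k + 2) (M := M) (N := N) (L := L) (a := a)
    (b := b) (c := c) hNpos (by omega) (by gcongr) (by gcongr) (by linarith)
    (by
      have : c * k ≤ c * (N * L) := by gcongr
      linarith)
    (by
      have : a * (N * L) ≤ a * (k + L) := by gcongr
      linarith)
    (by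
      have : (2 * (a - b) + c) * k ≤ (2 * (a - b) + c) * (N * L) := by gcongr
      push_cast
      linarith)
    (by
      have : a * k ≤ a * (N * L) := by gcongr
      push_cast
      linarith) (by omega)
  rw [hpatch]
  have e1 : Real.exp (-(1 / N * n)) ≤ Real.exp (-(Real.log n / (k + 1))) :=
    Real.exp_le_exp.2 (neg_le_neg hrate)
  -- With N ≤ n, the choice m = k + 2 turns n · n^(-(k+2)/(k+1)) into n^(-1/(k+1)).
  have e2 : N * Real.exp (-(((k + 2 : ℕ) : ℝ) / N * n)) ≤
      Real.exp (-(Real.log n / (k + 1))) := by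
    calc N * Real.exp (-(((k + 2 : ℕ) : ℝ) / N * n))
        ≤ Real.exp (Real.log n) * Real.exp (-((k + 2) * (Real.log n / (k + 1)))) := by
          rw [Real.exp_log hn0']
          refine mul_le_mul hNn (Real.exp_le_exp.2 (neg_le_neg ?_)) (Real.exp_pos _).le hn0'.le
          calc ((k : ℝ) + 2) * (Real.log n / (k + 1)) ≤ (k + 2) * (1 / N * n) := by gcongr
            _ = ((k + 2 : ℕ) : ℝ) / N * n := by
              push_cast
              ring
      _ = Real.exp (-(Real.log n / (k + 1))) := by
          rw [← Real.exp_add]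
          congr 1
          field_simp
          ring
  have e3 : N * ((((k + 2) * M + M).choose (k + 2) : ℕ) *
      Real.exp (-(((k + 2 : ℕ) : ℝ) / N * n))) ≤
      (((k + 2) * M + M).choose (k + 2) : ℕ) * Real.exp (-(Real.log n / (k + 1))) := by
    rw [mul_left_comm]
    gcongr
  have e4 : (M : ℝ) * Real.exp (-(1 / N * n)) ≤ M * Real.exp (-(Real.log n / (k + 1))) := by
    gcongr
  have hD : D * Real.exp (-(Real.log n / (k + 1))) =
      (((k + 2) * M + M).choose (k + 2) : ℕ) * Real.exp (-(Real.log n / (k + 1))) +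
        2 * M * Real.exp (-(Real.log n / (k + 1))) := add_mul _ _ _
  linarith

theorem mainTheorem9 (a b c : ℝ) (hc : 0 < c) (hcb : c < b) (hba : b < a)
    (h : 1 < a - b + c ∨ (1 / 2 < a - b ∧ 1 < a)) :
    Tendsto (fun n : ℕ => probConnected n (patchSet a b c n)) atTop (𝓝 1) := by
  rcases h with h | ⟨h, h'⟩
  · exact tendsto_probConnected hc hcb hba (by linarith) (by linarith)
  · exact tendsto_probConnected hc hcb hba (by linarith) h'
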